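/- For integers $l\ge 1$ define the generalized Bernoulli numbers $B_n^{(l)}\in\mathbb{Q}$ by $\left(\frac{z}{e^{z}-1}\right)^{l}=\sum_{n\ge 0}B_n^{(l)}\frac{z^n}{n!}$, and put $z_k=(2k-1)\pi i$ for $k\ge 1$. Let $m\ge 3$ be odd. (a) For each $1\le l\le m$ the numbers $$b_j^{(l)}=\frac{(-1)^{l-j}B_{l-j}^{(l)}}{(l-j)!},\qquad 1\le j\le l,$$ are the unique complex numbers such that, for all $k\ge 1$, $$\lim_{z\to z_k}\frac{1}{(l-1)!}\left(\frac{d}{dz}\right)^{l-1}\frac{(z-z_k)^l}{z(e^z+1)^l}=-\sum_{j=1}^{l}\frac{b_j^{(l)}}{z_k^{\,j}} .$$ (b) The upper triangular linear system $$\sum_{l=j}^{m} b_j^{(l)}\,w_l=\begin{cases}0,&1\le j<m,\\ -(-1)^{(m-1)/2}\,\Gamma(m),&j=m,\end{cases}$$ has exactly one solution $(w_1,\dots,w_m)\in\mathbb{Q}^m$. (c) For this solution the function $u\mapsto\sum_{l=1}^{m}\sum_{p=0}^{l-1}\frac{w_l(1-e^{u})e^{up}}{u(e^{u}+1)^{l}}$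 is integrable on $(0,\infty)$, and $$\zeta(m)=\frac{(2\pi)^{m-1}}{(2^m-1)\Gamma(m)}\int_0^\infty\sum_{l=1}^{m}\sum_{p=0}^{l-1}\frac{w_l(1-e^{u})e^{up}}{u(e^{u}+1)^{l}}\,du .$$ Equivalently, with the sums outside: each summand is integrable on $(0,R)$ for every $R>0$, and $$\zeta(m)=\frac{(2\pi)^{m-1}}{(2^m-1)\Gamma(m)}\lim_{R\to\infty}\sum_{l=1}^{m}\sum_{p=0}^{l-1}\int_0^R\frac{w_l(1-e^{u})e^{up}}{u(e^{u}+1)^{l}}\,du .$$ -/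

import Mathlib

open scoped Nat

noncomputable section

/-- The formal power series `(e^X - 1) / X = ∑ X ^ n / (n + 1)!` over `ℚ`. -/
def expSubOneDivX : PowerSeries ℚ := PowerSeries.mk fun n => 1 / ((n + 1)! : ℚ)

theorem X_mul_expSubOneDivX :
    PowerSeries.X * expSubOneDivX = PowerSeries.exp ℚ - 1 := by
  ext n
  cases n with
  | zero => simp
  | succ n =>
    rw [mul_comm, PowerSeries.coeff_succ_mul_X]
    simp [expSubOneDivX, PowerSeries.coeff_exp, PowerSeries.coeff_one]

/-- The generating series `(X / (e^X - 1)) ^ l = ∑ B_n^{(l)} X ^ n / n!` of the generalized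
Bernoulli numbers of order `l`. -/
def genBernoulliSeries (l : ℕ) : PowerSeries ℚ := expSubOneDivX⁻¹ ^ l

/-- The series above is indeed the `l`-th power of `X / (e^X - 1)`. -/
theorem genBernoulliSeries_mul (l : ℕ) :
    genBernoulliSeries l * (PowerSeries.exp ℚ - 1) ^ l = PowerSeries.X ^ l := by
  have h : PowerSeries.constantCoeff expSubOneDivX ≠ 0 := by
    rw [← PowerSeries.coeff_zero_eq_constantCoeff_apply]
    simp [expSubOneDivX]
  rw [genBernoulliSeries, ← X_mul_expSubOneDivX, ← mul_pow, mul_left_comm,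
    PowerSeries.inv_mul_cancel _ h, mul_one]

/-- The generalized Bernoulli number `B_n^{(l)}` of order `l`. -/
def genBernoulli (l n : ℕ) : ℚ := (n ! : ℚ) * PowerSeries.coeff n (genBernoulliSeries l)

/-- The number `(-1)^{l-j} B_{l-j}^{(l)} / (l-j)!`, for `1 ≤ j ≤ l`. -/
def bCoeff (l j : ℕ) : ℚ := (-1) ^ (l - j) * genBernoulli l (l - j) / ((l - j)! : ℚ)

/-- The point `z_k = (2k-1)πi`, a zero of `e^z + 1`. -/
def oddPole (k : ℕ) : ℂ := (2 * (k : ℂ) - 1) * (Real.pi : ℂ) * Complex.I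

/-- The function `g_l(z) = (z - z_k)^l / (z (e^z + 1)^l)`. -/
def gFun (l k : ℕ) (z : ℂ) : ℂ := (z - oddPole k) ^ l / (z * (Complex.exp z + 1) ^ l)

/-- `b_1, …, b_l` are the coefficients in the expansion in powers of `1 / z_k` of
`D_l = lim_{z → z_k} g_l^{(l-1)}(z) / (l-1)!` (the residue of `1 / (z (e^z + 1)^l)` at `z_k`):
for all `k ≥ 1`, the limit exists and `D_l = -(b_l / z_k^l + ⋯ + b_1 / z_k)`. -/
def IsResidueExpansion (l : ℕ) (b : ℕ → ℂ) : Prop :=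
  ∀ k : ℕ, 1 ≤ k →
    Filter.Tendsto (fun z : ℂ => iteratedDeriv (l - 1) (gFun l k) z / ((l - 1)! : ℂ))
      (nhdsWithin (oddPole k) {oddPole k}ᶜ)
      (nhds (-∑ j ∈ Finset.Icc 1 l, b j / oddPole k ^ j))

/-- The upper triangular `m × m` matrix of the system for the weights: the entry in row `j` and
column `l` (both counted from `1`) is `b_j^{(l)}` for `j ≤ l`, and `0` for `j > l`. -/
def weightMatrix (m : ℕ) : Matrix (Fin m) (Fin m) ℚ :=
  Matrix.of fun j l => if j ≤ l then bCoeff ((l : ℕ) + 1) ((j : ℕ) + 1) else 0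

/-- `S_m = (-1)^{(m-1)/2} Γ(m) = (-1)^{(m-1)/2} (m-1)!`, for odd `m`. -/
def sConst (m : ℕ) : ℚ := (-1) ^ ((m - 1) / 2) * ((m - 1)! : ℚ)

/-- The right-hand side `(0, …, 0, -S_m)ᵀ` of the system. -/
def weightRHS (m : ℕ) : Fin m → ℚ := fun j => if (j : ℕ) + 1 = m then -sConst m else 0

/-- The integrand `w (1 - e^u) e^{up} / (u (e^u + 1)^l)`. -/
def zetaTerm (w : ℚ) (l p : ℕ) (u : ℝ) : ℝ :=
  (w : ℝ) * (1 - Real.exp u) * Real.exp (u * p) / (u * (Real.exp u + 1) ^ l)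

/-- The factor `(2π)^{m-1} / ((2^m - 1) Γ(m))`. -/
def zetaFactor (m : ℕ) : ℝ :=
  (2 * Real.pi) ^ (m - 1) / ((2 ^ m - 1) * Real.Gamma (m : ℝ))

end

noncomputable section

/-! Let `s(u) = 1/(e^u + 1)`, so that `s' = s^2 - s` and `s^{(n)} = P_n(s)` with `P_n =
logisticDeriv^[n] X`. The number `(-1)^j b_j^{(l)}` is the coefficient of `(z - z_k)^{-j}` in the
Laurent expansion of `s^l` at `z_k`. The triangular system therefore asks that `∑ w_l s^l` have a
pure pole of order `m` at `z_k`, with a prescribed coefficient. The derivative `s^{(m-1)}` has a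
pure pole of this order, since `s` has a simple one. So the weights are the coefficients of
`P_{m-1}` up to the sign `-(-1)^{(m-1)/2}` (`bFunctional_iterate_logisticDeriv`,
`weightMatrix_mulVec_eq_iff`).

With `m = 2r + 1`, the geometric sum over `p` gives `w_l (s^l - (1 - s)^l) / u`. As `P_{2r}` is odd
under `X ↦ 1 - X`, the integrand collapses to `-2 (-1)^r s^{(2r)}(u) / u`
(`zetaIntegrand_eq_aeval`). Differentiating the cotangent expansion writes `s^{(2r)}` as a sum over
the poles `±ia`, `a = (2j+1)π`. Conjugate poles combine into rescaled copies of `Im (1 - iu)^{-m} /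
u` (`hasSum_zetaIntegrand`). The integral of that kernel over the half-line is `π/2`, whatever `m ≥
1`. Dominated convergence leaves `2π (2r)! ∑ a^{-m}`, the sum over odd integers behind `ζ(m)`. -/

open Polynomial in
/-- The derivation `p ↦ p' (X² - X)`: if `s' = s² - s`, then `(p ∘ s)' = (logisticDeriv p) ∘ s`. -/
def logisticDeriv : ℚ[X] →ₗ[ℚ] ℚ[X] :=
  (LinearMap.mulRight ℚ (X ^ 2 - X)).comp Polynomial.derivative

open Polynomial in
theorem logisticDeriv_apply (p : ℚ[X]) : logisticDeriv p = derivative p * (X ^ 2 - X) := rfl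

/-! ### Generalized Bernoulli numbers and the solution of the triangular system -/

section Coefficients

theorem bCoeff_eq_coeff (l j : ℕ) :
    bCoeff l j = (-1) ^ (l - j) * PowerSeries.coeff (l - j) (genBernoulliSeries l) := by
  have : ((l - j)! : ℚ) ≠ 0 := by positivity
  rw [bCoeff, genBernoulli]
  field_simp

theorem constantCoeff_expSubOneDivX_ne_zero : PowerSeries.constantCoeff expSubOneDivX ≠ 0 := by
  rw [← PowerSeries.coeff_zero_eq_constantCoeff_apply]
  simp [expSubOneDivX]

theorem constantCoeff_genBernoulliSeries (l : ℕ) :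
    PowerSeries.constantCoeff (genBernoulliSeries l) = 1 := by
  have : PowerSeries.constantCoeff expSubOneDivX = 1 := by
    rw [← PowerSeries.coeff_zero_eq_constantCoeff_apply]
    simp [expSubOneDivX]
  simp [genBernoulliSeries, PowerSeries.constantCoeff_inv, this]

theorem bCoeff_self (l : ℕ) : bCoeff l l = 1 := by
  rw [bCoeff_eq_coeff]
  simp [constantCoeff_genBernoulliSeries]

/-- For `E = (e^X - 1)/X` and `F = 1/E`, differentiating `X E = e^X - 1` gives `E + X E' = 1 + X E`.
Multiplying by `F^2` and using `E' F = -E F'` yields this Riccati equation, the formal counterpart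
of `s' = s^2 - s`. -/
theorem X_mul_derivative_inv_expSubOneDivX :
    PowerSeries.X * PowerSeries.derivative ℚ expSubOneDivX⁻¹ =
      expSubOneDivX⁻¹ - PowerSeries.X * expSubOneDivX⁻¹ - expSubOneDivX⁻¹ ^ 2 := by
  have h := X_mul_expSubOneDivX
  have hd := congrArg (PowerSeries.derivative ℚ) h
  have hi := PowerSeries.mul_inv_cancel _ constantCoeff_expSubOneDivX_ne_zero
  have hid := congrArg (PowerSeries.derivative ℚ) hi
  simp only [Derivation.leibniz, map_sub, PowerSeries.derivative_X, Derivation.map_one_eq_zero,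
    smul_eq_mul, PowerSeries.derivative_exp, mul_one, sub_zero] at hd hid
  set E := expSubOneDivX
  set F := expSubOneDivX⁻¹
  set E' := PowerSeries.derivative ℚ E
  set F' := PowerSeries.derivative ℚ F
  linear_combination (F - PowerSeries.X * F - PowerSeries.X * F') * hi
    + PowerSeries.X * F * hid - F ^ 2 * hd + F ^ 2 * h

theorem X_mul_derivative_genBernoulliSeries (l : ℕ) :
    PowerSeries.X * PowerSeries.derivative ℚ (genBernoulliSeries l) =
      (l : PowerSeries ℚ) * (genBernoulliSeries l - PowerSeries.X * genBernoulliSeries l -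
        genBernoulliSeries (l + 1)) := by
  simp only [genBernoulliSeries]
  cases l with
  | zero => simp
  | succ l =>
    rw [Derivation.leibniz_pow]
    have h := X_mul_derivative_inv_expSubOneDivX
    simp only [Nat.add_sub_cancel, smul_eq_mul, nsmul_eq_mul]
    linear_combination ((l + 1 : ℕ) : PowerSeries ℚ) * expSubOneDivX⁻¹ ^ l * h

theorem coeff_genBernoulliSeries_recurrence_succ (l n : ℕ) :
    (l : ℚ) * PowerSeries.coeff (n + 1) (genBernoulliSeries (l + 1)) =
      (l - (n + 1)) * PowerSeries.coeff (n + 1) (genBernoulliSeries l) -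
        l * PowerSeries.coeff n (genBernoulliSeries l) := by
  have h := congrArg (PowerSeries.coeff (n + 1)) (X_mul_derivative_genBernoulliSeries l)
  rw [← map_natCast (PowerSeries.C (R := ℚ)) l, PowerSeries.coeff_C_mul] at h
  simp only [map_sub, PowerSeries.coeff_succ_X_mul, PowerSeries.coeff_derivative] at h
  linear_combination h

/-- `b_j^{(l)}`, extended by zero to `j > l`. -/
def bCoeffExt (l j : ℕ) : ℚ := if j ≤ l then bCoeff l j else 0

/-- For `j < l` this compares coefficients in the differential equation of the generating series.
The extension by zero makes it hold for all `j`: at `j = l` it reduces to `b_l^{(l)} = 1` on both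
diagonals. -/
theorem bCoeffExt_recurrence (l j : ℕ) :
    (l : ℚ) * (bCoeffExt (l + 1) (j + 1) - bCoeffExt l (j + 1)) = j * bCoeffExt l j := by
  rcases lt_trichotomy j l with h | h | h
  · obtain ⟨n, rfl⟩ : ∃ n, l = j + n + 1 := ⟨l - j - 1, by omega⟩
    have h1 : j + n + 1 + 1 - (j + 1) = n + 1 := by omega
    have h2 : j + n + 1 - (j + 1) = n := by omega
    have h3 : j + n + 1 - j = n + 1 := by omega
    rw [bCoeffExt, bCoeffExt, bCoeffExt, if_pos (by omega), if_pos (by omega), if_pos (by omega),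
      bCoeff_eq_coeff, bCoeff_eq_coeff, bCoeff_eq_coeff, h1, h2, h3]
    have := coeff_genBernoulliSeries_recurrence_succ (j + n + 1) n
    push_cast at this ⊢
    linear_combination (-1) ^ (n + 1) * this
  · subst h
    simp [bCoeffExt, bCoeff_self]
  · rw [bCoeffExt, bCoeffExt, bCoeffExt, if_neg (by omega), if_neg (by omega), if_neg (by omega)]
    simp

open Polynomial

/-- The linear functional `X ^ l ↦ b_j^{(l)}`. -/
def bFunctional (j : ℕ) : ℚ[X] →ₗ[ℚ] ℚ :=
  Polynomial.lsum fun l => LinearMap.mulRight ℚ (bCoeffExt l j)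

theorem bFunctional_monomial (j l : ℕ) (a : ℚ) :
    bFunctional j (monomial l a) = a * bCoeffExt l j := by
  simp [bFunctional, Polynomial.lsum_apply, Polynomial.sum_monomial_index]

/-- The functional reads off `(-1)^j` times the coefficient of `(z - z_k)^{-j}` in `p(s(z))`, and
differentiation sends `(z - z_k)^{-j}` to `-j (z - z_k)^{-j-1}`. Algebraically, on monomials it is
the recurrence for `b_j^{(l)}`. -/
theorem bFunctional_logisticDeriv (j : ℕ) (p : ℚ[X]) :
    bFunctional (j + 1) (logisticDeriv p) = j * bFunctional j p := by
  induction p using Polynomial.induction_on' with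
  | add p q hp hq => rw [map_add, map_add, map_add, hp, hq, mul_add]
  | monomial l a =>
    have : logisticDeriv (monomial l a) = monomial (l + 1) (a * l) - monomial l (a * l) := by
      cases l with
      | zero => simp [logisticDeriv_apply]
      | succ l =>
        rw [logisticDeriv_apply, derivative_monomial]
        simp only [← C_mul_X_pow_eq_monomial, Nat.add_sub_cancel]
        ring
    rw [this, map_sub, bFunctional_monomial, bFunctional_monomial, bFunctional_monomial]
    linear_combination a * bCoeffExt_recurrence l j

theorem bFunctional_iterate_logisticDeriv (n j : ℕ) :
    bFunctional (j + 1) (logisticDeriv^[n] X) = if j = n then (n ! : ℚ) else 0 := by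
  induction n generalizing j with
  | zero =>
    rw [Function.iterate_zero, id, ← monomial_one_one_eq_X, bFunctional_monomial]
    cases j <;> simp [bCoeffExt, bCoeff_self]
  | succ n ih =>
    rw [Function.iterate_succ_apply', bFunctional_logisticDeriv]
    cases j with
    | zero => simp
    | succ j =>
      rw [ih]
      by_cases h : j = n
      · simp [h, Nat.factorial_succ]
      · simp [h]

theorem natDegree_iterate_logisticDeriv_le (n : ℕ) :
    (logisticDeriv^[n] X).natDegree ≤ n + 1 := by
  induction n with
  | zero => simp
  | succ n ih =>
    rw [Function.iterate_succ_apply', logisticDeriv_apply]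
    refine natDegree_mul_le.trans ?_
    have h1 := natDegree_derivative_le (logisticDeriv^[n] (X : ℚ[X]))
    have h2 : (X ^ 2 - X : ℚ[X]).natDegree ≤ 2 := by compute_degree
    omega

theorem coeff_zero_iterate_logisticDeriv (n : ℕ) :
    (logisticDeriv^[n] X).coeff 0 = 0 := by
  cases n with
  | zero => simp
  | succ n => simp [Function.iterate_succ_apply', logisticDeriv_apply, mul_coeff_zero]

theorem iterate_logisticDeriv_eq_sum (n : ℕ) :
    logisticDeriv^[n] X =
      ∑ i : Fin (n + 1), monomial ((i : ℕ) + 1) ((logisticDeriv^[n] X).coeff ((i : ℕ) + 1)) := by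
  rw [Fin.sum_univ_eq_sum_range
    (fun i => monomial (i + 1) ((logisticDeriv^[n] (X : ℚ[X])).coeff (i + 1)))]
  conv_lhs => rw [as_sum_range' (logisticDeriv^[n] (X : ℚ[X])) (n + 2)
    (Nat.lt_succ_of_le (natDegree_iterate_logisticDeriv_le n)), Finset.sum_range_succ',
    coeff_zero_iterate_logisticDeriv]
  simp

theorem det_weightMatrix (m : ℕ) : (weightMatrix m).det = 1 := by
  rw [Matrix.det_of_isUpperTriangular]
  · simp [weightMatrix, bCoeff_self]
  · intro i j hij
    simp only [id] at hij
    simp [weightMatrix, hij]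

/-- The solution of the triangular system. -/
theorem weightMatrix_mulVec_eq_iff {m : ℕ} (hm : 1 ≤ m) (w : Fin m → ℚ) :
    (weightMatrix m).mulVec w = weightRHS m ↔
      w = fun i : Fin m => -(-1) ^ ((m - 1) / 2) * (logisticDeriv^[m - 1] X).coeff ((i : ℕ) + 1) := by
  set v : Fin m → ℚ :=
    fun i => -(-1) ^ ((m - 1) / 2) * (logisticDeriv^[m - 1] X).coeff ((i : ℕ) + 1) with hv
  have hsol : (weightMatrix m).mulVec v = weightRHS m := by
    obtain ⟨n, rfl⟩ : ∃ n, m = n + 1 := ⟨m - 1, by omega⟩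
    ext j
    -- Applying the functional of index `j + 1` to the monomial expansion of `P_n` produces row `j`
    -- of the system.
    have h := congrArg (bFunctional ((j : ℕ) + 1)) (iterate_logisticDeriv_eq_sum n)
    rw [bFunctional_iterate_logisticDeriv, map_sum] at h
    simp only [bFunctional_monomial, bCoeffExt, add_le_add_iff_right] at h
    simp only [Matrix.mulVec, dotProduct, weightMatrix, Matrix.of_apply, hv, weightRHS, sConst,
      Nat.add_sub_cancel, add_left_inj, Fin.le_def]
    trans -(-1) ^ (n / 2) * (if (j : ℕ) = n then (n ! : ℚ) else 0)
    · rw [h, Finset.mul_sum]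
      refine Finset.sum_congr rfl fun i _ => ?_
      split_ifs <;> ring
    · split_ifs <;> ring
  have hinj : Function.Injective (weightMatrix m).mulVec := by
    rw [Matrix.mulVec_injective_iff_isUnit, Matrix.isUnit_iff_isUnit_det, det_weightMatrix]
    exact isUnit_one
  rw [← hsol]
  exact hinj.eq_iff

/-- `X^2 - X` is invariant under `X ↦ 1 - X`, while `d/dX` changes sign, so each step flips the
parity. The start is at `P_1 = X^2 - X` because `X` itself has no parity. -/
theorem iterate_logisticDeriv_comp_one_sub (n : ℕ) :
    (logisticDeriv^[n + 1] X).comp (1 - X) = (-1) ^ n * logisticDeriv^[n + 1] X := by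
  induction n with
  | zero =>
    simp [logisticDeriv_apply]
    ring
  | succ n ih =>
    rw [Function.iterate_succ_apply']
    set p := logisticDeriv^[n + 1] (X : ℚ[X])
    have hd := congrArg derivative ih
    rw [derivative_comp] at hd
    have hc : derivative ((-1) ^ n * p) = (-1) ^ n * derivative p := by
      rcases neg_one_pow_eq_or ℚ[X] n with h | h <;> simp [h]
    rw [hc] at hd
    simp only [derivative_sub, derivative_one, derivative_X, zero_sub] at hd
    rw [logisticDeriv_apply, mul_comp, sub_comp, pow_comp, X_comp]
    linear_combination (-(X ^ 2 - X) : ℚ[X]) * hd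

end Coefficients

/-! ### Taylor expansion at the poles and the residue coefficients -/

section Residues

/-- The Taylor series of `f` at `c`, as a formal power series. -/
def taylorPowerSeries (f : ℂ → ℂ) (c : ℂ) : PowerSeries ℂ :=
  PowerSeries.mk fun n => iteratedDeriv n f c / (n ! : ℂ)

/-- This is the Leibniz rule divided by `n!`. It turns the higher derivative in the residue into a
product of formal series. -/
theorem taylorPowerSeries_mul {f g : ℂ → ℂ} {c : ℂ} (hf : AnalyticAt ℂ f c)
    (hg : AnalyticAt ℂ g c) :
    taylorPowerSeries (f * g) c = taylorPowerSeries f c * taylorPowerSeries g c := by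
  ext n
  rw [PowerSeries.coeff_mul, Finset.Nat.sum_antidiagonal_eq_sum_range_succ_mk]
  simp only [taylorPowerSeries, PowerSeries.coeff_mk]
  rw [iteratedDeriv_mul hf.contDiffAt hg.contDiffAt, Finset.sum_div]
  refine Finset.sum_congr rfl fun i hi => ?_
  have hi' : i ≤ n := by simpa [Nat.lt_succ_iff] using hi
  rw [Nat.cast_choose ℂ hi']
  have h1 : (i ! : ℂ) ≠ 0 := by exact_mod_cast i.factorial_ne_zero
  have h2 : ((n - i)! : ℂ) ≠ 0 := by exact_mod_cast (n - i).factorial_ne_zero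
  have h3 : (n ! : ℂ) ≠ 0 := by exact_mod_cast n.factorial_ne_zero
  field_simp

theorem taylorPowerSeries_congr {f g : ℂ → ℂ} {c : ℂ} (h : f =ᶠ[nhds c] g) :
    taylorPowerSeries f c = taylorPowerSeries g c := by
  ext n
  simp only [taylorPowerSeries, PowerSeries.coeff_mk, h.iteratedDeriv_eq n]

theorem taylorPowerSeries_one (c : ℂ) : taylorPowerSeries 1 c = 1 := by
  ext n
  simp only [taylorPowerSeries, PowerSeries.coeff_mk, PowerSeries.coeff_one, Pi.one_def,
    iteratedDeriv_const]
  split_ifs with h <;> simp [h]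

theorem taylorPowerSeries_pow {f : ℂ → ℂ} {c : ℂ} (hf : AnalyticAt ℂ f c) (l : ℕ) :
    taylorPowerSeries (f ^ l) c = taylorPowerSeries f c ^ l := by
  induction l with
  | zero => simp [taylorPowerSeries_one]
  | succ l ih => rw [pow_succ, taylorPowerSeries_mul (hf.pow l) hf, ih, pow_succ]

theorem taylorPowerSeries_id (c : ℂ) :
    taylorPowerSeries (fun z => z) c = PowerSeries.C c + PowerSeries.X := by
  ext n
  simp only [taylorPowerSeries, PowerSeries.coeff_mk, map_add, PowerSeries.coeff_C,
    PowerSeries.coeff_X, iteratedDeriv_fun_id]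
  rcases n with _ | _ | n <;> simp

theorem taylorPowerSeries_sub_self (c : ℂ) :
    taylorPowerSeries (fun z => z - c) c = PowerSeries.X := by
  ext n
  have := congrFun (iteratedDeriv_comp_sub_const n (fun z : ℂ => z) c) c
  simp only [taylorPowerSeries, PowerSeries.coeff_mk, this, iteratedDeriv_fun_id,
    PowerSeries.coeff_X]
  rcases n with _ | _ | n <;> simp

theorem exp_oddPole (k : ℕ) : Complex.exp (oddPole k) = -1 := by
  have : oddPole k = (k : ℤ) * (2 * Real.pi * Complex.I) - Real.pi * Complex.I := by
    rw [oddPole]; push_cast; ring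
  rw [this, Complex.exp_sub, Complex.exp_int_mul_two_pi_mul_I, Complex.exp_pi_mul_I]
  norm_num

theorem oddPole_injective : Function.Injective oddPole := by
  intro a b h
  have h1 := mul_right_cancel₀ (Complex.ofReal_ne_zero.2 Real.pi_ne_zero)
    (mul_right_cancel₀ Complex.I_ne_zero h)
  have h2 : (a : ℂ) = b := by linear_combination h1 / 2
  exact_mod_cast h2

theorem oddPole_ne_zero (k : ℕ) : oddPole k ≠ 0 := by
  intro h
  have := exp_oddPole k
  rw [h, Complex.exp_zero] at this
  norm_num at this

/-- `(e^z + 1) / (z - z_k)`, with the singularity at `z_k` removed. -/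
def expAddOneSlope (k : ℕ) : ℂ → ℂ := dslope (fun z => Complex.exp z + 1) (oddPole k)

theorem sub_mul_expAddOneSlope (k : ℕ) (z : ℂ) :
    (z - oddPole k) * expAddOneSlope k z = Complex.exp z + 1 := by
  have := sub_smul_dslope (fun z => Complex.exp z + 1) (oddPole k) z
  simpa [expAddOneSlope, exp_oddPole] using this

theorem analyticAt_expAddOneSlope (k : ℕ) (z : ℂ) : AnalyticAt ℂ (expAddOneSlope k) z := by
  have : DifferentiableOn ℂ (expAddOneSlope k) Set.univ :=
    (Complex.differentiableOn_dslope Filter.univ_mem).2 (by fun_prop)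
  exact this.analyticAt Filter.univ_mem

theorem expAddOneSlope_oddPole (k : ℕ) : expAddOneSlope k (oddPole k) = -1 := by
  simp [expAddOneSlope, exp_oddPole]

/-- Since `e^{z_k} = -1`, one has `e^z + 1 = -(e^{z - z_k} - 1)`. The factor `z - z_k` is cancelled
in the domain of power series. -/
theorem taylorPowerSeries_expAddOneSlope (k : ℕ) :
    taylorPowerSeries (expAddOneSlope k) (oddPole k) =
      -(PowerSeries.map (algebraMap ℚ ℂ) expSubOneDivX) := by
  have h : taylorPowerSeries (fun z => Complex.exp z + 1) (oddPole k) =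
      -(PowerSeries.map (algebraMap ℚ ℂ) (PowerSeries.exp ℚ - 1)) := by
    ext n
    rcases n with _ | n
    · simp [taylorPowerSeries, exp_oddPole]
    · have : iteratedDeriv (n + 1) (fun z => Complex.exp z + 1) (oddPole k) = -1 := by
        rw [iteratedDeriv_succ']
        have : deriv (fun z => Complex.exp z + 1) = Complex.exp := by
          ext z; simp
        rw [this, iteratedDeriv_eq_iterate, Complex.iter_deriv_exp, exp_oddPole]
      simp [taylorPowerSeries, this, PowerSeries.coeff_exp, PowerSeries.coeff_one, neg_div]
  have hm : (fun z => Complex.exp z + 1) = (fun z => z - oddPole k) * expAddOneSlope k := by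
    ext z; simp [sub_mul_expAddOneSlope]
  rw [hm, taylorPowerSeries_mul (by fun_prop) (analyticAt_expAddOneSlope k _),
    taylorPowerSeries_sub_self, ← X_mul_expSubOneDivX, map_mul, PowerSeries.map_X, ← mul_neg] at h
  exact mul_left_cancel₀ PowerSeries.X_ne_zero h

/-- The analytic continuation of `gFun l k` to `z_k`. -/
def gFunExtension (l k : ℕ) (z : ℂ) : ℂ := (z * expAddOneSlope k z ^ l)⁻¹

theorem gFun_eq_gFunExtension (l k : ℕ) {z : ℂ} (hz : z ≠ oddPole k) :
    gFun l k z = gFunExtension l k z := by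
  have h : (z - oddPole k) ^ l ≠ 0 := pow_ne_zero _ (sub_ne_zero.2 hz)
  rw [gFun, gFunExtension, ← sub_mul_expAddOneSlope, mul_pow, mul_left_comm, ← div_div,
    div_self h, one_div]

theorem analyticAt_gFunExtension (l k : ℕ) : AnalyticAt ℂ (gFunExtension l k) (oddPole k) := by
  refine AnalyticAt.inv (analyticAt_id.mul ((analyticAt_expAddOneSlope k _).pow l)) ?_
  simp [expAddOneSlope_oddPole, oddPole_ne_zero]

/-- The first factor is the geometric series of `1/z` at `z_k`. The second is the inverse of the
`l`-th power of the slope. -/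
theorem taylorPowerSeries_gFunExtension (l k : ℕ) :
    taylorPowerSeries (gFunExtension l k) (oddPole k) =
      PowerSeries.mk (fun n => (-1) ^ n / oddPole k ^ (n + 1)) *
        ((-1) ^ l * PowerSeries.map (algebraMap ℚ ℂ) (genBernoulliSeries l)) := by
  set c := oddPole k with hc
  have hc0 : c ≠ 0 := oddPole_ne_zero k
  set E := PowerSeries.map (algebraMap ℚ ℂ) expSubOneDivX with hE
  set G := PowerSeries.map (algebraMap ℚ ℂ) (genBernoulliSeries l) with hG
  set R : PowerSeries ℂ := PowerSeries.mk (fun n => (-1) ^ n / c ^ (n + 1)) with hR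
  have hEG : E ^ l * G = 1 := by
    rw [hE, hG, ← map_pow, ← map_mul, genBernoulliSeries, ← mul_pow,
      PowerSeries.mul_inv_cancel _ constantCoeff_expSubOneDivX_ne_zero, one_pow, map_one]
  have hcR : (PowerSeries.C c + PowerSeries.X) * R = 1 := by
    ext n
    rw [add_mul, map_add, PowerSeries.coeff_C_mul]
    rcases n with _ | n
    · simp [hR, hc0]
    · rw [PowerSeries.coeff_succ_X_mul]
      simp only [hR, PowerSeries.coeff_mk, PowerSeries.coeff_one, Nat.succ_ne_zero, if_false]
      field_simp
      ring
  have hT : (PowerSeries.C c + PowerSeries.X) * (-E) ^ l *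
      taylorPowerSeries (gFunExtension l k) c = 1 := by
    have hD : AnalyticAt ℂ (expAddOneSlope k ^ l) c := (analyticAt_expAddOneSlope k c).pow l
    have hzD : AnalyticAt ℂ ((fun z : ℂ => z) * expAddOneSlope k ^ l) c := analyticAt_id.mul hD
    rw [← taylorPowerSeries_id, hE, ← taylorPowerSeries_expAddOneSlope,
      ← taylorPowerSeries_pow (analyticAt_expAddOneSlope k c),
      ← taylorPowerSeries_mul (f := fun z => z) analyticAt_id hD,
      ← taylorPowerSeries_mul hzD (analyticAt_gFunExtension l k), ← taylorPowerSeries_one c]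
    refine taylorPowerSeries_congr ?_
    have hne : ((fun z : ℂ => z) * expAddOneSlope k ^ l) c ≠ 0 := by
      simp [hc, expAddOneSlope_oddPole, oddPole_ne_zero]
    filter_upwards [hzD.continuousAt.eventually_ne hne] with z hz
    simpa [gFunExtension] using mul_inv_cancel₀ hz
  rw [neg_pow] at hT
  have h1 : ((-1 : PowerSeries ℂ) ^ l) * (-1) ^ l = 1 := by
    rw [← mul_pow]; simp
  set T := taylorPowerSeries (gFunExtension l k) c
  calc T = (((PowerSeries.C c + PowerSeries.X) * R) * (((-1) ^ l * (-1) ^ l) * (E ^ l * G))) * T := by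
        rw [hcR, hEG, h1]; ring
    _ = R * ((-1) ^ l * G) * ((PowerSeries.C c + PowerSeries.X) * ((-1) ^ l * E ^ l) * T) := by ring
    _ = _ := by rw [hT, mul_one]

theorem iteratedDeriv_gFunExtension {l : ℕ} (hl : 1 ≤ l) (k : ℕ) :
    iteratedDeriv (l - 1) (gFunExtension l k) (oddPole k) / ((l - 1)! : ℂ) =
      -∑ j ∈ Finset.Icc 1 l, (bCoeff l j : ℂ) / oddPole k ^ j := by
  obtain ⟨n, rfl⟩ : ∃ n, l = n + 1 := ⟨l - 1, by omega⟩
  have h := congrArg (PowerSeries.coeff n) (taylorPowerSeries_gFunExtension (n + 1) k)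
  rw [PowerSeries.coeff_mul, Finset.Nat.sum_antidiagonal_eq_sum_range_succ_mk] at h
  simp only [taylorPowerSeries, PowerSeries.coeff_mk] at h
  rw [Nat.add_sub_cancel, h, show Finset.Icc 1 (n + 1) = Finset.Ico 1 (n + 2) from rfl,
    Finset.sum_Ico_eq_sum_range, ← Finset.sum_neg_distrib]
  refine Finset.sum_congr rfl fun i hi => ?_
  obtain ⟨d, rfl⟩ : ∃ d, n = i + d := ⟨n - i, by simp at hi; omega⟩
  have hs : ((-1 : PowerSeries ℂ)) ^ (i + d + 1) = PowerSeries.C ((-1) ^ (i + d + 1)) := by simp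
  have hi2 : (-1 : ℂ) ^ i * (-1) ^ i = 1 := by rw [← mul_pow]; simp
  rw [bCoeff_eq_coeff, hs, PowerSeries.coeff_C_mul, PowerSeries.coeff_map,
    show i + d + 1 - (1 + i) = d by omega, show i + d - i = d by omega, add_comm 1 i]
  push_cast
  simp only [eq_ratCast]
  rw [pow_succ (-1 : ℂ) (i + d), pow_add (-1 : ℂ) i d, div_mul_eq_mul_div, ← neg_div]
  congr 1
  linear_combination
    (-(-1) ^ d * ((PowerSeries.coeff d (genBernoulliSeries (i + d + 1)) : ℚ) : ℂ)) * hi2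

theorem tendsto_iteratedDeriv_gFun {l : ℕ} (hl : 1 ≤ l) (k : ℕ) :
    Filter.Tendsto (fun z : ℂ => iteratedDeriv (l - 1) (gFun l k) z / ((l - 1)! : ℂ))
      (nhdsWithin (oddPole k) {oddPole k}ᶜ)
      (nhds (-∑ j ∈ Finset.Icc 1 l, (bCoeff l j : ℂ) / oddPole k ^ j)) := by
  rw [← iteratedDeriv_gFunExtension hl]
  have hcont : ContinuousAt (iteratedDeriv (l - 1) (gFunExtension l k)) (oddPole k) := by
    rw [iteratedDeriv_eq_iterate]
    exact ((analyticAt_gFunExtension l k).iterated_deriv _).continuousAt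
  refine ((hcont.div_const _).tendsto.mono_left nhdsWithin_le_nhds).congr' ?_
  filter_upwards [self_mem_nhdsWithin] with z hz
  have hEq : Set.EqOn (gFun l k) (gFunExtension l k) {oddPole k}ᶜ := fun z hz =>
    gFun_eq_gFunExtension l k hz
  rw [hEq.iteratedDeriv_of_isOpen isOpen_compl_singleton (l - 1) hz]

theorem isResidueExpansion_iff {l : ℕ} (hl : 1 ≤ l) (b : ℕ → ℂ) :
    IsResidueExpansion l b ↔ ∀ j ∈ Finset.Icc 1 l, b j = (bCoeff l j : ℂ) := by
  constructor
  · intro h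
    -- Two expansions with the same limits differ by a polynomial in `1/z_k` vanishing at infinitely
    -- many points.
    set q : Polynomial ℂ :=
      ∑ j ∈ Finset.Icc 1 l, Polynomial.monomial j (b j - (bCoeff l j : ℂ)) with hq
    have hroot : ∀ k : ℕ, 1 ≤ k → q.IsRoot (oddPole k)⁻¹ := by
      intro k hk
      have := tendsto_nhds_unique (h k hk) (tendsto_iteratedDeriv_gFun hl k)
      simp only [Polynomial.IsRoot, hq, Polynomial.eval_finsetSum, Polynomial.eval_monomial,
        inv_pow, ← div_eq_mul_inv, sub_div, Finset.sum_sub_distrib]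
      rw [neg_inj.1 this, sub_self]
    have hq0 : q = 0 := by
      refine Polynomial.eq_zero_of_infinite_isRoot q ?_
      refine Set.infinite_of_injective_forall_mem (f := fun k : ℕ => (oddPole (k + 1))⁻¹) ?_
        fun k => hroot (k + 1) (by omega)
      intro a b hab
      simpa using oddPole_injective (inv_injective hab)
    intro j hj
    have hc := congrArg (Polynomial.coeff · j) hq0
    simp only [hq, Polynomial.finsetSum_coeff, Polynomial.coeff_monomial, Polynomial.coeff_zero,
      Finset.sum_ite_eq', hj, if_true] at hc
    exact sub_eq_zero.1 hc
  · intro h k _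
    rw [Finset.sum_congr rfl fun j hj => by rw [h j hj]]
    exact tendsto_iteratedDeriv_gFun hl k

end Residues

/-! ### The kernel attached to a pair of conjugate poles -/

section LorentzKernel

open MeasureTheory Filter

/-- `Im (1 - iu)^{-n} / u`. -/
def lorentzKernel (n : ℕ) (u : ℝ) : ℝ := (((1 - Complex.I * u)⁻¹ ^ n).im) / u

theorem one_sub_I_mul_ne_zero (u : ℝ) : 1 - Complex.I * (u : ℂ) ≠ 0 := by
  intro h
  have := congrArg Complex.re h
  simp at this

theorem normSq_one_sub_I_mul (u : ℝ) : Complex.normSq (1 - Complex.I * u) = 1 + u ^ 2 := by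
  simp [Complex.normSq_apply]
  ring

theorem norm_inv_one_sub_I_mul_le_one (u : ℝ) : ‖(1 - Complex.I * (u : ℂ))⁻¹‖ ≤ 1 := by
  rw [norm_inv]
  refine inv_le_one_of_one_le₀ ?_
  simpa using Complex.abs_re_le_norm (1 - Complex.I * (u : ℂ))

/-- With `W = 1/(1 - iu)`, take imaginary parts in `W^{n+1} = W^n + iu W^{n+1}`. -/
theorem lorentzKernel_succ (n : ℕ) {u : ℝ} (hu : u ≠ 0) :
    lorentzKernel (n + 1) u = lorentzKernel n u + (((1 - Complex.I * u)⁻¹ ^ (n + 1)).re) := by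
  have h : (1 - Complex.I * (u : ℂ))⁻¹ ^ (n + 1) =
      (1 - Complex.I * u)⁻¹ ^ n + Complex.I * u * (1 - Complex.I * u)⁻¹ ^ (n + 1) := by
    have := mul_inv_cancel₀ (one_sub_I_mul_ne_zero u)
    rw [pow_succ]
    linear_combination ((1 - Complex.I * (u : ℂ))⁻¹ ^ n) * this
  have him := congrArg Complex.im h
  simp only [Complex.add_im, Complex.mul_im, Complex.mul_re, Complex.I_re, Complex.I_im,
    Complex.ofReal_re, Complex.ofReal_im] at him
  rw [lorentzKernel, lorentzKernel, div_add' _ _ _ hu]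
  congr 1
  linarith

theorem lorentzKernel_eq_sum (n : ℕ) {u : ℝ} (hu : u ≠ 0) :
    lorentzKernel n u = ∑ j ∈ Finset.range n, ((1 - Complex.I * (u : ℂ))⁻¹ ^ (j + 1)).re := by
  induction n with
  | zero => simp [lorentzKernel]
  | succ n ih => rw [lorentzKernel_succ n hu, ih, Finset.sum_range_succ]

theorem re_inv_one_sub_I_mul (u : ℝ) : (1 - Complex.I * (u : ℂ))⁻¹.re = (1 + u ^ 2)⁻¹ := by
  rw [Complex.inv_re, normSq_one_sub_I_mul]
  simp

theorem abs_re_inv_one_sub_I_mul_pow_le (n : ℕ) (u : ℝ) :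
    |((1 - Complex.I * (u : ℂ))⁻¹ ^ (n + 1)).re| ≤ (1 + u ^ 2)⁻¹ := by
  -- `|W|` decays only like `1/u`, so the first power needs the exact value of its real part; higher
  -- powers are bounded by `|W|^2`.
  cases n with
  | zero => rw [zero_add, pow_one, re_inv_one_sub_I_mul, abs_of_pos (by positivity)]
  | succ n =>
    refine (Complex.abs_re_le_norm _).trans ?_
    have h2 : ‖(1 - Complex.I * (u : ℂ))⁻¹‖ ^ 2 = (1 + u ^ 2)⁻¹ := by
      rw [norm_inv, inv_pow, ← Complex.normSq_eq_norm_sq, normSq_one_sub_I_mul]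
    rw [norm_pow, ← h2]
    exact pow_le_pow_of_le_one (norm_nonneg _) (norm_inv_one_sub_I_mul_le_one u) (by omega)

theorem abs_lorentzKernel_le (n : ℕ) {u : ℝ} (hu : u ≠ 0) :
    |lorentzKernel n u| ≤ n * (1 + u ^ 2)⁻¹ := by
  rw [lorentzKernel_eq_sum n hu]
  refine (Finset.abs_sum_le_sum_abs _ _).trans ?_
  refine (Finset.sum_le_sum fun j _ => abs_re_inv_one_sub_I_mul_pow_le j u).trans ?_
  simp

theorem continuous_re_inv_one_sub_I_mul_pow (n : ℕ) :
    Continuous fun u : ℝ => ((1 - Complex.I * (u : ℂ))⁻¹ ^ n).re :=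
  Complex.continuous_re.comp
    ((Continuous.inv₀ (by fun_prop) fun u => one_sub_I_mul_ne_zero u).pow n)

theorem integrable_re_inv_one_sub_I_mul_pow (n : ℕ) :
    Integrable fun u : ℝ => ((1 - Complex.I * (u : ℂ))⁻¹ ^ (n + 1)).re :=
  integrable_inv_one_add_sq.mono' (continuous_re_inv_one_sub_I_mul_pow _).aestronglyMeasurable
    (Eventually.of_forall fun u => abs_re_inv_one_sub_I_mul_pow_le n u)

theorem hasDerivAt_im_inv_one_sub_I_mul_pow (n : ℕ) (u : ℝ) :
    HasDerivAt (fun u : ℝ => ((1 - Complex.I * (u : ℂ))⁻¹ ^ (n + 1)).im / (n + 1))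
      (((1 - Complex.I * (u : ℂ))⁻¹ ^ (n + 2)).re) u := by
  have h0 := one_sub_I_mul_ne_zero u
  have h1 : HasDerivAt (fun z : ℂ => (1 - Complex.I * z)⁻¹ ^ (n + 1))
      (((n + 1 : ℕ) : ℂ) * (1 - Complex.I * (u : ℂ))⁻¹ ^ n *
        (-(-(Complex.I * 1)) / (1 - Complex.I * (u : ℂ)) ^ 2)) (u : ℂ) :=
    ((((hasDerivAt_id (u : ℂ)).const_mul Complex.I).const_sub 1).inv h0).pow (n + 1)
  have h2 := h1.comp_ofReal
  have h3 := (Complex.imCLM.hasFDerivAt.comp_hasDerivAt u h2).div_const ((n : ℝ) + 1)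
  refine h3.congr_deriv ?_
  have : ((n + 1 : ℕ) : ℂ) * (1 - Complex.I * (u : ℂ))⁻¹ ^ n *
      (-(-(Complex.I * 1)) / (1 - Complex.I * (u : ℂ)) ^ 2) =
      ((n + 1 : ℝ) : ℂ) * (Complex.I * (1 - Complex.I * (u : ℂ))⁻¹ ^ (n + 2)) := by
    push_cast
    rw [div_eq_mul_inv, ← inv_pow]
    ring
  have hn : (n : ℝ) + 1 ≠ 0 := by positivity
  rw [this, Complex.imCLM_apply, Complex.im_ofReal_mul, mul_div_cancel_left₀ _ hn]
  simp

theorem integral_re_inv_one_sub_I_mul_pow (n : ℕ) :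
    ∫ u in Set.Ioi (0 : ℝ), ((1 - Complex.I * (u : ℂ))⁻¹ ^ (n + 2)).re = 0 := by
  have hlim : Tendsto (fun u : ℝ => ((1 - Complex.I * (u : ℂ))⁻¹ ^ (n + 1)).im / (n + 1))
      atTop (nhds 0) := by
    refine squeeze_zero_norm' ?_ tendsto_inv_atTop_zero
    filter_upwards [eventually_gt_atTop 0] with u hu
    rw [norm_div, Real.norm_eq_abs, Real.norm_eq_abs]
    refine (div_le_self (abs_nonneg _) ?_).trans ((Complex.abs_im_le_norm _).trans ?_)
    · rw [abs_of_pos (by positivity)]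
      simp
    · rw [norm_pow]
      refine (pow_le_of_le_one (norm_nonneg _) (norm_inv_one_sub_I_mul_le_one u)
        n.succ_ne_zero).trans ?_
      rw [norm_inv]
      refine inv_anti₀ hu ?_
      have := Complex.abs_im_le_norm (1 - Complex.I * (u : ℂ))
      simpa [abs_of_pos hu] using this
  rw [integral_Ioi_of_hasDerivAt_of_tendsto'
    (fun u _ => hasDerivAt_im_inv_one_sub_I_mul_pow n u)
    (integrable_re_inv_one_sub_I_mul_pow (n + 1)).integrableOn hlim]
  simp

theorem integrableOn_lorentzKernel (n : ℕ) : IntegrableOn (lorentzKernel n) (Set.Ioi 0) := by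
  refine IntegrableOn.congr_fun (f := fun u : ℝ => ∑ j ∈ Finset.range n,
    ((1 - Complex.I * (u : ℂ))⁻¹ ^ (j + 1)).re) ?_
    (fun u hu => (lorentzKernel_eq_sum n (ne_of_gt hu)).symm) measurableSet_Ioi
  exact integrable_finsetSum _ fun j _ => (integrable_re_inv_one_sub_I_mul_pow j).integrableOn

/-- The kernel is the sum of `Re W^{j+1}` over `j ≤ n`. For `j ≥ 1` the primitive `Im W^j / j`
vanishes at `0` and at infinity, so only `∫ 1/(1 + u^2)` survives. -/
theorem integral_lorentzKernel (n : ℕ) :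
    ∫ u in Set.Ioi (0 : ℝ), lorentzKernel (n + 1) u = Real.pi / 2 := by
  rw [setIntegral_congr_fun measurableSet_Ioi
    fun u hu => lorentzKernel_eq_sum (n + 1) (ne_of_gt hu),
    integral_finsetSum _ fun j _ => (integrable_re_inv_one_sub_I_mul_pow j).integrableOn,
    Finset.sum_range_succ']
  simp only [integral_re_inv_one_sub_I_mul_pow, Finset.sum_const_zero, zero_add, pow_one,
    re_inv_one_sub_I_mul]
  simp

theorem integral_lorentzKernel_div (n : ℕ) {a : ℝ} (ha : 0 < a) :
    ∫ u in Set.Ioi (0 : ℝ), lorentzKernel (n + 1) (u / a) = a * (Real.pi / 2) := by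
  have := integral_comp_mul_right_Ioi (lorentzKernel (n + 1)) 0 (inv_pos.2 ha)
  simpa [integral_lorentzKernel, div_eq_mul_inv] using this

theorem integrableOn_lorentzKernel_div (n : ℕ) {a : ℝ} (ha : 0 < a) :
    IntegrableOn (fun u => lorentzKernel n (u / a)) (Set.Ioi 0) := by
  have := (integrableOn_Ioi_comp_mul_left_iff (lorentzKernel n) 0 (inv_pos.2 ha)).2
    (by simpa using integrableOn_lorentzKernel n)
  simpa [div_eq_inv_mul] using this

/-- For `a ≥ 1`, `1/(1 + u^2/a^2) = a^2/(a^2 + u^2) ≤ a^2/(1 + u^2)`. The dependence on `a`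
separates from that on `u`, as a summable majorant needs. -/
theorem abs_lorentzKernel_div_le (n : ℕ) {a u : ℝ} (ha : 1 ≤ a) (hu : 0 < u) :
    |lorentzKernel n (u / a)| ≤ n * a ^ 2 * (1 + u ^ 2)⁻¹ := by
  refine (abs_lorentzKernel_le n (by positivity)).trans ?_
  rw [mul_assoc]
  gcongr
  rw [← div_eq_mul_inv, inv_le_comm₀ (by positivity) (by positivity), inv_div]
  rw [div_le_iff₀ (by positivity), div_pow]
  have : (0 : ℝ) < a ^ 2 := by positivity
  have h1 : (1 + u ^ 2 / a ^ 2) * a ^ 2 = a ^ 2 + u ^ 2 := by field_simp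
  nlinarith

end LorentzKernel

/-! ### Partial fractions of the derivatives of the logistic function -/

section PartialFractions

open Polynomial UpperHalfPlane

/-- The constant `c` absorbs the shift `-πi` between the cotangent and the logistic function; at
least one derivative is taken, which kills it. -/
theorem iteratedDerivWithin_aeval_of_hasDerivAt {s : ℂ → ℂ} {U : Set ℂ} (hU : IsOpen U) {κ : ℂ}
    (hs : ∀ z ∈ U, HasDerivAt s (κ * (s z ^ 2 - s z)) z) (a c : ℂ) (p : ℚ[X]) (n : ℕ) :
    ∀ z ∈ U, iteratedDerivWithin (n + 1) (fun z => a * aeval (s z) p + c) U z =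
      a * κ ^ (n + 1) * aeval (s z) (logisticDeriv^[n + 1] p) := by
  have hd : ∀ (q : ℚ[X]) (b c : ℂ), ∀ z ∈ U,
      derivWithin (fun z => b * aeval (s z) q + c) U z =
        b * κ * aeval (s z) (logisticDeriv q) := by
    intro q b c z hz
    rw [derivWithin_of_isOpen hU hz]
    have h := ((Polynomial.hasDerivAt_aeval q (s z)).comp z (hs z hz)).const_mul b |>.add_const c
    refine h.deriv.trans ?_
    simp only [logisticDeriv_apply, map_mul, map_sub, map_pow, aeval_X]
    ring
  induction n with
  | zero =>
    intro z hz
    rw [zero_add, iteratedDerivWithin_one, hd p a c z hz, pow_one, Function.iterate_one]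
  | succ n ih =>
    intro z hz
    rw [iteratedDerivWithin_succ, derivWithin_congr (f := fun z => a * κ ^ (n + 1) *
      aeval (s z) (logisticDeriv^[n + 1] p) + 0) (fun y hy => by simp only [ih y hy, add_zero])
      (by simp only [ih z hz, add_zero]), hd _ _ _ z hz, Function.iterate_succ_apply' _ (n + 1)]
    ring

/-- `-q / (1 - q)` with `q = e^{2πiz}`. -/
def qLogistic (z : ℂ) : ℂ :=
  -(Complex.exp (2 * Real.pi * Complex.I * z) / (1 - Complex.exp (2 * Real.pi * Complex.I * z)))

theorem one_sub_exp_two_pi_I_mul_ne_zero {z : ℂ} (hz : z ∈ upperHalfPlaneSet) :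
    1 - Complex.exp (2 * Real.pi * Complex.I * z) ≠ 0 := by
  have := UpperHalfPlane.norm_exp_two_pi_I_lt_one ⟨z, hz⟩
  intro h
  have h1 : Complex.exp (2 * Real.pi * Complex.I * z) = 1 := (sub_eq_zero.1 h).symm
  simp [h1] at this

theorem hasDerivAt_qLogistic {z : ℂ} (hz : z ∈ upperHalfPlaneSet) :
    HasDerivAt qLogistic (-(2 * Real.pi * Complex.I) * (qLogistic z ^ 2 - qLogistic z)) z := by
  have h0 := one_sub_exp_two_pi_I_mul_ne_zero hz
  have he : HasDerivAt (fun z => Complex.exp (2 * Real.pi * Complex.I * z))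
      (Complex.exp (2 * Real.pi * Complex.I * z) * (2 * Real.pi * Complex.I * 1)) z :=
    ((hasDerivAt_id z).const_mul _).cexp
  refine ((he.div (he.const_sub 1) h0).neg).congr_deriv ?_
  simp only [qLogistic]
  field_simp
  ring

theorem pi_mul_cot_eq_qLogistic {z : ℂ} (hz : z ∈ upperHalfPlaneSet) :
    Real.pi * Complex.cot (Real.pi * z) =
      2 * Real.pi * Complex.I * qLogistic z + -(Real.pi * Complex.I) := by
  have h0 := one_sub_exp_two_pi_I_mul_ne_zero hz
  rw [Complex.cot_pi_eq_exp_ratio, qLogistic, mul_comm Complex.I (1 - _), ← div_div, Complex.div_I]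
  generalize Complex.exp (2 * Real.pi * Complex.I * z) = q at *
  field_simp
  ring

theorem aeval_qLogistic_iterate_logisticDeriv (n : ℕ) {z : ℂ} (hz : z ∈ upperHalfPlaneSet) :
    aeval (qLogistic z) (logisticDeriv^[n + 1] X) =
      -((n + 1)! : ℂ) * (-1) ^ (n + 1) *
        ∑' k : ℤ, 1 / (-(2 * Real.pi * Complex.I) * (z + k)) ^ (n + 2) := by
  have h1 := iteratedDerivWithin_cot_pi_mul_eq_mul_tsum_div_pow (k := n + 1) (by omega) hz
  have h2 := iteratedDerivWithin_aeval_of_hasDerivAt isOpen_upperHalfPlaneSet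
    (fun z hz => hasDerivAt_qLogistic hz) (2 * Real.pi * Complex.I) (-(Real.pi * Complex.I))
    X n z hz
  have hcongr : Set.EqOn (fun z : ℂ => (Real.pi : ℂ) * Complex.cot (Real.pi * z))
      (fun z => 2 * Real.pi * Complex.I * aeval (qLogistic z) (X : ℚ[X]) + -(Real.pi * Complex.I))
      upperHalfPlaneSet := fun z hz => by
    simp only [aeval_X]
    exact pi_mul_cot_eq_qLogistic hz
  rw [iteratedDerivWithin_congr hcongr hz, h2] at h1
  simp only [mul_pow _ _ (n + 2), ← one_div_mul_one_div, tsum_mul_left]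
  have hpi : -(2 * Real.pi * Complex.I) ≠ 0 := neg_ne_zero.2 Complex.two_pi_I_ne_zero
  have hpow : (-(2 * Real.pi * Complex.I)) ^ (n + 2) ≠ 0 := pow_ne_zero _ hpi
  field_simp
  rw [show n + 2 = (n + 1) + 1 from rfl, pow_succ]
  linear_combination -h1

/-- On the line `Re z = 1/2` one has `q = -e^{-u}`, which carries the cotangent variable to the real
variable of the integral. -/
theorem qLogistic_of_real (u : ℝ) :
    qLogistic (1 / 2 + Complex.I * u / (2 * Real.pi)) = (((Real.exp u + 1)⁻¹ : ℝ) : ℂ) := by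
  have hpi : (Real.pi : ℂ) ≠ 0 := Complex.ofReal_ne_zero.2 Real.pi_ne_zero
  have h : Complex.exp (2 * Real.pi * Complex.I * (1 / 2 + Complex.I * u / (2 * Real.pi))) =
      -(Complex.exp u)⁻¹ := by
    have : 2 * Real.pi * Complex.I * (1 / 2 + Complex.I * u / (2 * Real.pi)) =
        Real.pi * Complex.I + -u := by
      field_simp
      linear_combination (u : ℂ) * Complex.I_sq
    rw [this, Complex.exp_add, Complex.exp_pi_mul_I, Complex.exp_neg]
    ring
  have h1 : Complex.exp u + 1 ≠ 0 := by
    rw [← Complex.ofReal_exp]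
    exact_mod_cast (by positivity : Real.exp u + 1 ≠ 0)
  have h2 := Complex.exp_ne_zero u
  have h3 : 1 - -(Complex.exp u)⁻¹ = (Complex.exp u + 1) * (Complex.exp u)⁻¹ := by
    rw [add_mul, mul_inv_cancel₀ h2, one_mul, sub_neg_eq_add]
  rw [qLogistic, h, h3, neg_div, neg_neg, div_mul_cancel_right₀ (inv_ne_zero h2)]
  push_cast
  rfl

/-- The modulus `(2j+1)π` of the zeros of `e^z + 1`. -/
def oddPi (j : ℕ) : ℝ := (2 * j + 1) * Real.pi

theorem one_le_oddPi (j : ℕ) : 1 ≤ oddPi j := by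
  have h1 := Real.pi_gt_three
  have h2 : (0 : ℝ) ≤ j := by positivity
  rw [oddPi]
  nlinarith

theorem oddPi_pos (j : ℕ) : 0 < oddPi j := zero_lt_one.trans_le (one_le_oddPi j)

theorem summable_one_div_oddPi_pow {n : ℕ} (hn : 2 ≤ n) :
    Summable fun j => 1 / oddPi j ^ n := by
  have h := (Real.summable_one_div_nat_pow.2 hn).comp_injective
    (i := fun j : ℕ => 2 * j + 1) (fun a b hab => by simpa using hab)
  refine (h.mul_left (1 / Real.pi ^ n)).congr fun j => ?_
  simp only [Function.comp_apply, oddPi, mul_pow]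
  push_cast
  rw [one_div_mul_one_div, mul_comm]

theorem norm_ofReal_add_mul_I_ge (u a : ℝ) : |a| ≤ ‖(u : ℂ) + Complex.I * a‖ := by
  simpa using Complex.abs_im_le_norm ((u : ℂ) + Complex.I * a)

theorem summable_one_div_add_I_mul_oddPi_pow {n : ℕ} (hn : 2 ≤ n) (u ε : ℝ) (hε : |ε| = 1) :
    Summable fun j => 1 / ((u : ℂ) + Complex.I * (ε * oddPi j : ℝ)) ^ n := by
  refine (summable_one_div_oddPi_pow hn).of_norm_bounded fun j => ?_
  rw [norm_div, norm_one, norm_pow]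
  have := norm_ofReal_add_mul_I_ge u (ε * oddPi j)
  rw [abs_mul, hε, one_mul, abs_of_pos (oddPi_pos j)] at this
  have := oddPi_pos j
  gcongr

theorem hasSum_aeval_iterate_logisticDeriv (n : ℕ) {u : ℝ} (hu : 0 < u) :
    HasSum (fun j => -((n + 1)! : ℂ) * (-1) ^ (n + 1) *
      (1 / ((u : ℂ) + Complex.I * ((-1) * oddPi j : ℝ)) ^ (n + 2) +
        1 / ((u : ℂ) + Complex.I * (1 * oddPi j : ℝ)) ^ (n + 2)))
      ((aeval ((Real.exp u + 1)⁻¹ : ℝ) (logisticDeriv^[n + 1] X : ℚ[X]) : ℝ) : ℂ) := by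
  have hpi : (Real.pi : ℂ) ≠ 0 := Complex.ofReal_ne_zero.2 Real.pi_ne_zero
  have hz : (1 / 2 + Complex.I * u / (2 * Real.pi)) ∈ upperHalfPlaneSet := by
    have : (1 / 2 + Complex.I * u / (2 * Real.pi) : ℂ) =
        ((1 / 2 : ℝ) : ℂ) + ((u / (2 * Real.pi) : ℝ) : ℂ) * Complex.I := by
      push_cast; ring
    rw [this]
    simp only [upperHalfPlaneSet, Set.mem_ofPred_eq, Complex.add_im, Complex.ofReal_im,
      Complex.im_ofReal_mul, Complex.I_im]
    positivity
  have h := aeval_qLogistic_iterate_logisticDeriv n hz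
  have hlin : ∀ k : ℤ, -(2 * Real.pi * Complex.I) *
      (1 / 2 + Complex.I * u / (2 * Real.pi) + k) =
      u + Complex.I * ((-(2 * k + 1)) * Real.pi : ℝ) := by
    intro k
    push_cast
    field_simp
    linear_combination (-(u : ℂ)) * Complex.I_sq
  simp only [hlin] at h
  have hcast := aeval_algebraMap_apply ℂ ((Real.exp u + 1)⁻¹) (logisticDeriv^[n + 1] X : ℚ[X])
  simp only [Complex.coe_algebraMap] at hcast
  rw [qLogistic_of_real, hcast] at h
  rw [h]
  refine HasSum.mul_left _ ?_
  have hs1 := summable_one_div_add_I_mul_oddPi_pow (n := n + 2) (by omega) u (-1) (by simp)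
  have hs2 := summable_one_div_add_I_mul_oddPi_pow (n := n + 2) (by omega) u 1 (by simp)
  have he1 : (fun j : ℕ => 1 / ((u : ℂ) + Complex.I * ((-1) * oddPi j : ℝ)) ^ (n + 2)) =
      fun j : ℕ => 1 / ((u : ℂ) +
        Complex.I * ((-(2 * ((j : ℤ) : ℝ) + 1)) * Real.pi : ℝ)) ^ (n + 2) := by
    ext j; rw [oddPi, neg_one_mul, neg_mul, Int.cast_natCast]
  -- The integers `k = j` and `k = -(j+1)` give the poles with `-(2k+1)π` equal to `-(2j+1)π` and
  -- `(2j+1)π`.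
  have he2 : (fun j : ℕ => 1 / ((u : ℂ) + Complex.I * (1 * oddPi j : ℝ)) ^ (n + 2)) =
      fun j : ℕ => 1 / ((u : ℂ) +
        Complex.I * ((-(2 * ((-((j : ℤ) + 1) : ℤ) : ℝ) + 1)) * Real.pi : ℝ)) ^ (n + 2) := by
    ext j; rw [oddPi]; push_cast; ring_nf
  rw [tsum_of_nat_of_neg_add_one (he1 ▸ hs1) (he2 ▸ hs2), ← he1, ← he2]
  exact hs1.hasSum.add hs2.hasSum

/-- The two terms are conjugate, so their sum is twice a real part. Factoring `u + ia = ia(1 -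
iu/a)`, the odd power of `i` turns that real part into an imaginary part with sign `(-1)^r`. -/
theorem one_div_add_I_mul_pow_add_conj (r : ℕ) (u : ℝ) {a : ℝ} (ha : 0 < a) :
    1 / ((u : ℂ) + Complex.I * ((-1) * a : ℝ)) ^ (2 * r + 1) +
      1 / ((u : ℂ) + Complex.I * (1 * a : ℝ)) ^ (2 * r + 1) =
    ((2 * ((-1) ^ r / a ^ (2 * r + 1) *
      ((1 - Complex.I * ((u / a : ℝ) : ℂ))⁻¹ ^ (2 * r + 1)).im) : ℝ) : ℂ) := by
  have ha' : (a : ℂ) ≠ 0 := Complex.ofReal_ne_zero.2 ha.ne'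
  have hconj : 1 / ((u : ℂ) + Complex.I * ((-1) * a : ℝ)) ^ (2 * r + 1) =
      (starRingEnd ℂ) (1 / ((u : ℂ) + Complex.I * (1 * a : ℝ)) ^ (2 * r + 1)) := by
    simp
  have hfac : (u : ℂ) + Complex.I * (1 * a : ℝ) =
      Complex.I * a * (1 - Complex.I * ((u / a : ℝ) : ℂ)) := by
    push_cast
    field_simp
    linear_combination (u : ℂ) * Complex.I_sq
  have hI : (Complex.I ^ (2 * r + 1))⁻¹ = -(((-1) ^ r : ℝ) : ℂ) * Complex.I := by
    refine inv_eq_of_mul_eq_one_left ?_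
    rw [pow_succ, pow_mul, Complex.I_sq]
    push_cast
    have : ((-1 : ℂ) ^ r) * (-1) ^ r = 1 := by rw [← mul_pow]; simp
    linear_combination (-((-1 : ℂ) ^ r * (-1) ^ r)) * Complex.I_sq + this
  rw [hconj, add_comm, Complex.add_conj]
  congr 2
  rw [hfac, one_div, mul_pow, mul_pow, mul_inv, mul_inv, hI, ← inv_pow (1 - _)]
  set W := (1 - Complex.I * ((u / a : ℝ) : ℂ))⁻¹ ^ (2 * r + 1)
  have : -(((-1) ^ r : ℝ) : ℂ) * Complex.I * ((a : ℂ) ^ (2 * r + 1))⁻¹ * W =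
      (((-1) ^ r / a ^ (2 * r + 1) : ℝ) : ℂ) * (-(Complex.I * W)) := by
    push_cast
    ring
  rw [this, Complex.re_ofReal_mul]
  simp

end PartialFractions

/-! ### Termwise integration and the value of the zeta function -/

section ZetaIntegral

open Polynomial MeasureTheory Filter

/-- The integrand of the integral formula for `ζ(m)`. -/
def zetaIntegrand {m : ℕ} (w : Fin m → ℚ) (u : ℝ) : ℝ :=
  ∑ i : Fin m, ∑ p ∈ Finset.range ((i : ℕ) + 1), zetaTerm (w i) ((i : ℕ) + 1) p u

theorem sum_zetaTerm (w : ℚ) (l : ℕ) (u : ℝ) :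
    ∑ p ∈ Finset.range l, zetaTerm w l p u =
      (w * (Real.exp u + 1)⁻¹ ^ l - w * (1 - (Real.exp u + 1)⁻¹) ^ l) / u := by
  have h1 : Real.exp u + 1 ≠ 0 := by positivity
  have hσ : 1 - (Real.exp u + 1)⁻¹ = Real.exp u / (Real.exp u + 1) := by
    field_simp
    ring
  have hterm : ∀ p, zetaTerm w l p u =
      w / (u * (Real.exp u + 1) ^ l) * ((1 - Real.exp u) * Real.exp u ^ p) := by
    intro p
    rw [zetaTerm, mul_comm u (p : ℝ), Real.exp_nat_mul]
    ring
  rw [Finset.sum_congr rfl fun p _ => hterm p, ← Finset.mul_sum, ← Finset.mul_sum,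
    mul_neg_geom_sum, hσ, inv_pow, div_pow]
  ring

theorem zetaIntegrand_eq_aeval {r : ℕ} (hr : 1 ≤ r) {w : Fin (2 * r + 1) → ℚ}
    (hw : (weightMatrix (2 * r + 1)).mulVec w = weightRHS (2 * r + 1)) (u : ℝ) :
    zetaIntegrand w u =
      -2 * (-1) ^ r * aeval (Real.exp u + 1)⁻¹ (logisticDeriv^[2 * r] X) / u := by
  obtain ⟨s, rfl⟩ : ∃ s, r = s + 1 := ⟨r - 1, by omega⟩
  rw [weightMatrix_mulVec_eq_iff (by omega)] at hw
  have hdiv : (2 * (s + 1) + 1 - 1) / 2 = s + 1 := by omega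
  rw [hdiv, Nat.add_sub_cancel] at hw
  have hsum : ∀ x : ℝ, ∑ i : Fin (2 * (s + 1) + 1), (w i : ℝ) * x ^ ((i : ℕ) + 1) =
      -(-1) ^ (s + 1) * aeval x (logisticDeriv^[2 * (s + 1)] X) := by
    intro x
    conv_rhs => rw [iterate_logisticDeriv_eq_sum, map_sum, Finset.mul_sum]
    refine Finset.sum_congr rfl fun i _ => ?_
    rw [aeval_monomial, hw]
    simp only [eq_ratCast]
    push_cast
    ring
  have hsymm : ∀ x : ℝ, aeval (1 - x) (logisticDeriv^[2 * (s + 1)] X) =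
      -aeval x (logisticDeriv^[2 * (s + 1)] X) := by
    intro x
    have h := congrArg (aeval x) (iterate_logisticDeriv_comp_one_sub (2 * s + 1))
    rw [aeval_comp, (show Odd (2 * s + 1) from ⟨s, rfl⟩).neg_one_pow] at h
    rw [show 2 * s + 1 + 1 = 2 * (s + 1) from rfl] at h
    generalize logisticDeriv^[2 * (s + 1)] (X : ℚ[X]) = q at h ⊢
    simpa using h
  rw [zetaIntegrand, Finset.sum_congr rfl fun i _ => sum_zetaTerm (w i) _ u, ← Finset.sum_div,
    Finset.sum_sub_distrib, hsum, hsum, hsymm]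
  ring

/-- The two signs `(-1)^r`, from the weights and from the pairing of poles, cancel. Rewriting `1/u`
as `1/(a · (u/a))` accounts for the extra power of `a = oddPi j`. -/
theorem hasSum_zetaIntegrand {r : ℕ} (hr : 1 ≤ r) {w : Fin (2 * r + 1) → ℚ}
    (hw : (weightMatrix (2 * r + 1)).mulVec w = weightRHS (2 * r + 1)) {u : ℝ} (hu : 0 < u) :
    HasSum (fun j => 4 * ((2 * r)! : ℝ) / oddPi j ^ (2 * r + 2) *
      lorentzKernel (2 * r + 1) (u / oddPi j)) (zetaIntegrand w u) := by
  have h := hasSum_aeval_iterate_logisticDeriv (2 * r - 1) hu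
  rw [show 2 * r - 1 + 1 = 2 * r by omega, show 2 * r - 1 + 2 = 2 * r + 1 by omega] at h
  simp only [one_div_add_I_mul_pow_add_conj r u (oddPi_pos _)] at h
  have h' : HasSum (fun j => -((2 * r)! : ℝ) * (-1) ^ (2 * r) *
      (2 * ((-1) ^ r / oddPi j ^ (2 * r + 1) *
        ((1 - Complex.I * ((u / oddPi j : ℝ) : ℂ))⁻¹ ^ (2 * r + 1)).im)))
      (aeval (Real.exp u + 1)⁻¹ (logisticDeriv^[2 * r] X : ℚ[X])) := by
    rw [← Complex.hasSum_ofReal]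
    refine h.congr_fun fun j => ?_
    rw [Complex.ofReal_mul]
    push_cast
    rfl
  rw [zetaIntegrand_eq_aeval hr hw, mul_div_right_comm]
  refine (h'.mul_left (-2 * (-1) ^ r / u)).congr_fun fun j => ?_
  have ha := (oddPi_pos j).ne'
  have hsq : ((-1 : ℝ) ^ r) * (-1) ^ r = 1 := by rw [← mul_pow]; simp
  rw [lorentzKernel, pow_mul (-1 : ℝ) 2 r, neg_one_sq, one_pow]
  generalize ((1 - Complex.I * ((u / oddPi j : ℝ) : ℂ))⁻¹ ^ (2 * r + 1)).im = y
  have hu' := hu.ne'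
  rw [pow_succ (oddPi j) (2 * r + 1)]
  field_simp
  linear_combination (-4 * y) * hsq

theorem measurable_zetaTerm (w : ℚ) (l p : ℕ) : Measurable (zetaTerm w l p) := by
  unfold zetaTerm
  fun_prop

theorem measurable_zetaIntegrand {m : ℕ} (w : Fin m → ℚ) : Measurable (zetaIntegrand w) := by
  unfold zetaIntegrand
  exact Finset.measurable_fun_sum _ fun i _ => Finset.measurable_fun_sum _ fun p _ =>
    measurable_zetaTerm _ _ _

theorem norm_lorentzKernel_term_le (r j : ℕ) {u : ℝ} (hu : 0 < u) :
    ‖4 * ((2 * r)! : ℝ) / oddPi j ^ (2 * r + 2) * lorentzKernel (2 * r + 1) (u / oddPi j)‖ ≤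
      1 / oddPi j ^ (2 * r) * (4 * ((2 * r)! : ℝ) * (2 * r + 1) * (1 + u ^ 2)⁻¹) := by
  have ha := oddPi_pos j
  rw [norm_mul, Real.norm_of_nonneg (by positivity), Real.norm_eq_abs]
  refine (mul_le_mul_of_nonneg_left
    (abs_lorentzKernel_div_le (2 * r + 1) (one_le_oddPi j) hu) (by positivity)).trans_eq ?_
  push_cast
  rw [pow_add _ (2 * r) 2]
  field_simp

theorem hasSum_lorentzKernel_bound {r : ℕ} (hr : 1 ≤ r) (u : ℝ) :
    HasSum (fun j => 1 / oddPi j ^ (2 * r) * (4 * ((2 * r)! : ℝ) * (2 * r + 1) * (1 + u ^ 2)⁻¹))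
      ((∑' j, 1 / oddPi j ^ (2 * r)) * (4 * ((2 * r)! : ℝ) * (2 * r + 1) * (1 + u ^ 2)⁻¹)) :=
  (summable_one_div_oddPi_pow (by omega)).hasSum.mul_right _

theorem integrable_lorentzKernel_bound (r : ℕ) :
    Integrable fun u : ℝ =>
      (∑' j, 1 / oddPi j ^ (2 * r)) * (4 * ((2 * r)! : ℝ) * (2 * r + 1) * (1 + u ^ 2)⁻¹) :=
  (integrable_inv_one_add_sq.const_mul _).const_mul _

/-- Single summands may decay only like `1/u` (those with `p = l - 1` and nonzero weight), so
integrability comes from the series over the poles. Its majorant `∑ a^{-2r}` converges because `r ≥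
1`. -/
theorem integrableOn_zetaIntegrand {r : ℕ} (hr : 1 ≤ r) {w : Fin (2 * r + 1) → ℚ}
    (hw : (weightMatrix (2 * r + 1)).mulVec w = weightRHS (2 * r + 1)) :
    IntegrableOn (zetaIntegrand w) (Set.Ioi 0) := by
  refine (integrable_lorentzKernel_bound r).integrableOn.mono'
    (measurable_zetaIntegrand w).aestronglyMeasurable ?_
  filter_upwards [self_mem_ae_restrict measurableSet_Ioi] with u hu
  rw [← (hasSum_zetaIntegrand hr hw hu).tsum_eq]
  exact tsum_of_norm_bounded (hasSum_lorentzKernel_bound hr u)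
    fun j => norm_lorentzKernel_term_le r j hu

theorem hasSum_integral_zetaIntegrand {r : ℕ} (hr : 1 ≤ r) {w : Fin (2 * r + 1) → ℚ}
    (hw : (weightMatrix (2 * r + 1)).mulVec w = weightRHS (2 * r + 1)) :
    HasSum (fun j => 2 * Real.pi * ((2 * r)! : ℝ) * (1 / oddPi j ^ (2 * r + 1)))
      (∫ u in Set.Ioi (0 : ℝ), zetaIntegrand w u) := by
  have h : HasSum (fun j => ∫ u in Set.Ioi (0 : ℝ), 4 * ((2 * r)! : ℝ) / oddPi j ^ (2 * r + 2) *
      lorentzKernel (2 * r + 1) (u / oddPi j)) (∫ u in Set.Ioi (0 : ℝ), zetaIntegrand w u) := by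
    refine hasSum_integral_of_dominated_convergence
      (fun j u => 1 / oddPi j ^ (2 * r) * (4 * ((2 * r)! : ℝ) * (2 * r + 1) * (1 + u ^ 2)⁻¹))
      (fun j => ((integrableOn_lorentzKernel_div _ (oddPi_pos j)).const_mul _).1) (fun j => ?_)
      (Eventually.of_forall fun u => (hasSum_lorentzKernel_bound hr u).summable) ?_ ?_
    · filter_upwards [self_mem_ae_restrict measurableSet_Ioi] with u hu
      exact norm_lorentzKernel_term_le r j hu
    · simp only [(hasSum_lorentzKernel_bound hr _).tsum_eq]
      exact (integrable_lorentzKernel_bound r).integrableOn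
    · filter_upwards [self_mem_ae_restrict measurableSet_Ioi] with u hu
      exact hasSum_zetaIntegrand hr hw hu
  refine h.congr_fun fun j => ?_
  have ha := (oddPi_pos j).ne'
  rw [integral_const_mul, integral_lorentzKernel_div _ (oddPi_pos j),
    pow_succ (oddPi j) (2 * r + 1)]
  field_simp
  ring

theorem hasSum_one_div_odd_pow {m : ℕ} (hm : 2 ≤ m) :
    HasSum (fun j : ℕ => 1 / (2 * (j : ℝ) + 1) ^ m)
      ((1 - 1 / 2 ^ m) * ∑' n : ℕ, 1 / (n : ℝ) ^ m) := by
  have hs : Summable fun n : ℕ => 1 / (n : ℝ) ^ m := Real.summable_one_div_nat_pow.2 hm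
  -- The term `j = 0` is harmless: both sides are `1 / 0 = 0` there.
  have he : HasSum (fun j : ℕ => 1 / ((2 * j : ℕ) : ℝ) ^ m)
      (1 / 2 ^ m * ∑' n : ℕ, 1 / (n : ℝ) ^ m) := by
    refine (hs.hasSum.mul_left (1 / 2 ^ m)).congr_fun fun j => ?_
    push_cast
    rw [one_div_mul_one_div, mul_pow]
  have ho : Summable fun j : ℕ => 1 / ((2 * j + 1 : ℕ) : ℝ) ^ m :=
    hs.comp_injective (i := fun j : ℕ => 2 * j + 1) fun a b hab => by simpa using hab
  have h := (HasSum.even_add_odd (f := fun n : ℕ => 1 / (n : ℝ) ^ m) he ho.hasSum).unique hs.hasSum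
  have hval : (1 - 1 / 2 ^ m) * ∑' n : ℕ, 1 / (n : ℝ) ^ m =
      ∑' j : ℕ, 1 / ((2 * j + 1 : ℕ) : ℝ) ^ m := by
    linear_combination -h
  rw [hval]
  refine ho.hasSum.congr_fun fun j => ?_
  push_cast
  rfl

theorem zetaFactor_mul_integral_zetaIntegrand {r : ℕ} (hr : 1 ≤ r) {w : Fin (2 * r + 1) → ℚ}
    (hw : (weightMatrix (2 * r + 1)).mulVec w = weightRHS (2 * r + 1)) :
    zetaFactor (2 * r + 1) * ∫ u in Set.Ioi (0 : ℝ), zetaIntegrand w u =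
      ∑' n : ℕ, 1 / (n : ℝ) ^ (2 * r + 1) := by
  have hodd := (hasSum_one_div_odd_pow (m := 2 * r + 1) (by omega)).mul_left
    (2 * Real.pi * ((2 * r)! : ℝ) / Real.pi ^ (2 * r + 1))
  have hint : ∫ u in Set.Ioi (0 : ℝ), zetaIntegrand w u = _ :=
    (hasSum_integral_zetaIntegrand hr hw).unique (hodd.congr_fun fun j => by
      rw [oddPi, mul_pow]
      field_simp)
  have hΓ : Real.Gamma ((2 * r + 1 : ℕ) : ℝ) = ((2 * r)! : ℝ) := by
    rw [Nat.cast_succ, Real.Gamma_nat_eq_factorial]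
  have h2 : (2 : ℝ) ^ (2 * r + 1) - 1 ≠ 0 := by
    have : (1 : ℝ) < 2 ^ (2 * r + 1) := one_lt_pow₀ one_lt_two (by omega)
    linarith
  have hpi := Real.pi_ne_zero
  have hf : ((2 * r)! : ℝ) ≠ 0 := by positivity
  rw [hint, zetaFactor, hΓ, Nat.add_sub_cancel, mul_pow]
  generalize ∑' n : ℕ, 1 / (n : ℝ) ^ (2 * r + 1) = Z
  have h3 : (1 - 1 / (2 : ℝ) ^ (2 * r + 1)) = (2 ^ (2 * r + 1) - 1) / 2 ^ (2 * r + 1) := by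
    field_simp
  rw [h3, pow_succ Real.pi (2 * r)]
  field_simp
  ring

/-- The singularity at `0` is removable: `(1 - e^u)/u` is minus the slope of `exp` at `0`. -/
theorem intervalIntegrable_zetaTerm (w : ℚ) (l p : ℕ) {R : ℝ} (hR : 0 < R) :
    IntervalIntegrable (zetaTerm w l p) volume 0 R := by
  have hc : Continuous (dslope Real.exp 0) := by
    rw [← continuousOn_univ, continuousOn_dslope univ_mem]
    exact ⟨Real.continuous_exp.continuousOn, Real.differentiable_exp.differentiableAt⟩
  have hg : Continuous fun u : ℝ =>
      -(w : ℝ) * dslope Real.exp 0 u * Real.exp (u * p) / (Real.exp u + 1) ^ l :=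
    Continuous.div (by fun_prop) (by fun_prop) fun u => by positivity
  refine (hg.intervalIntegrable 0 R).congr fun u hu => ?_
  rw [Set.uIoc_of_le hR.le] at hu
  have hu0 : u ≠ 0 := hu.1.ne'
  rw [dslope_of_ne _ hu0, slope_def_field, zetaTerm, Real.exp_zero, sub_zero]
  field_simp
  ring

theorem tendsto_sum_integral_zetaTerm {m : ℕ} {w : Fin m → ℚ}
    (hint : IntegrableOn (zetaIntegrand w) (Set.Ioi 0)) :
    Tendsto (fun R : ℝ => ∑ i : Fin m, ∑ p ∈ Finset.range ((i : ℕ) + 1),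
        ∫ u in (0 : ℝ)..R, zetaTerm (w i) ((i : ℕ) + 1) p u)
      atTop (nhds (∫ u in Set.Ioi (0 : ℝ), zetaIntegrand w u)) := by
  refine (intervalIntegral_tendsto_integral_Ioi 0 hint tendsto_id).congr' ?_
  filter_upwards [eventually_gt_atTop 0] with R hR
  simp only [zetaIntegrand, id]
  have hi : ∀ i : Fin m, IntervalIntegrable
      (fun u => ∑ p ∈ Finset.range ((i : ℕ) + 1), zetaTerm (w i) ((i : ℕ) + 1) p u) volume 0 R :=
    fun i => (IntervalIntegrable.sum (Finset.range ((i : ℕ) + 1)) fun p _ =>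
      intervalIntegrable_zetaTerm (w i) _ p hR).congr fun u _ => Finset.sum_apply _ _ _
  rw [intervalIntegral.integral_finsetSum fun i _ => hi i]
  refine Finset.sum_congr rfl fun i _ => ?_
  rw [intervalIntegral.integral_finsetSum fun p _ => intervalIntegrable_zetaTerm _ _ _ hR]

end ZetaIntegral

end

theorem mainTheorem1 (m : ℕ) (hm : 3 ≤ m) (hodd : Odd m) :
    -- the coefficients of the system: the residue expansion determines them, and they are
    -- given by the generalized Bernoulli numbers
    (∀ l : ℕ, 1 ≤ l → l ≤ m → ∀ b : ℕ → ℂ,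
      IsResidueExpansion l b ↔ ∀ j ∈ Finset.Icc 1 l, b j = (bCoeff l j : ℂ)) ∧
    -- the triangular system has a unique rational solution
    (∃! w : Fin m → ℚ, (weightMatrix m).mulVec w = weightRHS m) ∧
    -- the formula; the weight with index l is `w i`, where l = i + 1
    ∀ w : Fin m → ℚ, (weightMatrix m).mulVec w = weightRHS m →
      MeasureTheory.IntegrableOn
        (fun u : ℝ => ∑ i : Fin m, ∑ p ∈ Finset.range ((i : ℕ) + 1),
          zetaTerm (w i) ((i : ℕ) + 1) p u) (Set.Ioi 0) ∧
      riemannZeta (m : ℂ) = ((zetaFactor m *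
        ∫ u in Set.Ioi (0 : ℝ), ∑ i : Fin m, ∑ p ∈ Finset.range ((i : ℕ) + 1),
          zetaTerm (w i) ((i : ℕ) + 1) p u : ℝ) : ℂ) ∧
      -- the same with the sums outside, as an improper integral at infinity
      (∀ (i : Fin m) (p : ℕ), p ∈ Finset.range ((i : ℕ) + 1) → ∀ R : ℝ, 0 < R →
        IntervalIntegrable (zetaTerm (w i) ((i : ℕ) + 1) p) MeasureTheory.volume 0 R) ∧
      Filter.Tendsto (fun R : ℝ => ((zetaFactor m *
          ∑ i : Fin m, ∑ p ∈ Finset.range ((i : ℕ) + 1),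
            ∫ u in (0 : ℝ)..R, zetaTerm (w i) ((i : ℕ) + 1) p u : ℝ) : ℂ))
        Filter.atTop (nhds (riemannZeta (m : ℂ))) := by
  obtain ⟨r, rfl⟩ := hodd
  have hr : 1 ≤ r := by omega
  refine ⟨fun l hl _ b => isResidueExpansion_iff hl b,
    ⟨_, (weightMatrix_mulVec_eq_iff (by omega) _).2 rfl,
      fun w hw => (weightMatrix_mulVec_eq_iff (by omega) w).1 hw⟩, fun w hw => ?_⟩
  have hint := integrableOn_zetaIntegrand hr hw
  have hzeta : riemannZeta ((2 * r + 1 : ℕ) : ℂ) = ((zetaFactor (2 * r + 1) *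
      ∫ u in Set.Ioi (0 : ℝ), zetaIntegrand w u : ℝ) : ℂ) := by
    rw [zetaFactor_mul_integral_zetaIntegrand hr hw, zeta_nat_eq_tsum_of_gt_one (by omega),
      Complex.ofReal_tsum]
    push_cast
    rfl
  refine ⟨hint, hzeta, fun i p _ R hR => intervalIntegrable_zetaTerm _ _ _ hR, ?_⟩
  rw [hzeta]
  exact (Complex.continuous_ofReal.tendsto _).comp
    ((tendsto_sum_integral_zetaTerm hint).const_mul (zetaFactor (2 * r + 1)))
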